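/- **Proposition.** Let $(X,d,(\alpha_i)_{i\in\mathbb N})$ be a computable metric space with bounded metric; that is, $(X,d)$ is a complete metric space with $d$ bounded, $(\alpha_i)$ is a dense sequence in $X$ (the special points), and the distances $d(\alpha_i,\alpha_j)$ are computable reals uniformly in $i,j$. Let $\mathcal P(X)$ be the set of Borel probability measures on $X$, let $(\delta_n)_{n\in\mathbb N}$ be the standard effective enumeration of the measures in $\mathcal P(X)$ that are concentrated on a finite set of special points and give each of them rational mass, and let $\pi$ be the Prokhorov metric on $\mathcal P(X)$. For real $p\ge 1$ let $$W_p(\mu,\nu)=\Bigl(\inf_{\gamma}\int_{X\times X} d(x,y)^p\,d\gamma(x,y)\Bigr)^{1/p},$$ where $\gamma$ ranges over the Borel probability measures on $X\times X$ with marginals $\mu$ and $\nu$. For a metric $\rho$ on $\mathcal P(X)$, a Cauchy name of $\mu$ with respect to $\rho$ is a function $f:\mathbb N\to\mathbb N$ with $\rho(\delta_{f(k)},\mu)\le 2^{-k}$ for all $k$. Two metrics $\rho_1,\rho_2$ on $\mathcal P(X)$ are called computably equivalent if there is an oracle program which, for every $\mu\in\mathcal P(X)$, computes from every Cauchy name of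 $\mu$ with respect to $\rho_1$ (given as oracle) a Cauchy name of $\mu$ with respect to $\rho_2$, and there is likewise an oracle program for the converse direction. Then for every real $p>1$ the metric $W_p$ is computably equivalent to $W_1$, and $W_p$ is computably equivalent to $\pi$. -/

import Mathlib

open MeasureTheory
open scoped ENNReal

/-- A computable metric space structure on the metric space `X`: a dense sequence of special points
whose mutual distances are computable reals, uniformly in the indices. The natural number
`q (i, j, k)` is the numerator of a dyadic approximation with error at most `2⁻ᵏ`. -/
structure ComputableMetricSpace (X : Type*) [MetricSpace X] where
  /-- the sequence of special points -/
  point : ℕ → X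
  denseRange_point : DenseRange point
  computable_dist : ∃ q : ℕ × ℕ × ℕ → ℕ, Computable q ∧
    ∀ i j k : ℕ, |dist (point i) (point j) - (q (i, j, k) : ℝ) / 2 ^ k| ≤ 1 / 2 ^ k

section RationalMeasures

variable {X : Type*} [MeasurableSpace X]

/-- The total weight of a list of pairs (index, weight). -/
def totalWeight (l : List (ℕ × ℕ)) : ℕ := (l.map Prod.snd).sum

/-- The measure `∑ w · δ_{x i}`, the sum over the pairs `(i, w)` in the list. -/
noncomputable def weightedSum (x : ℕ → X) (l : List (ℕ × ℕ)) : Measure X :=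
  (l.map fun a => (a.2 : ℝ≥0∞) • Measure.dirac (x a.1)).sum

theorem weightedSum_univ (x : ℕ → X) (l : List (ℕ × ℕ)) :
    weightedSum x l Set.univ = (totalWeight l : ℝ≥0∞) := by
  induction l with
  | nil => simp [weightedSum, totalWeight]
  | cons a l ih =>
    simp only [weightedSum, totalWeight, List.map_cons, List.sum_cons, Measure.add_apply,
      Measure.smul_apply, measure_univ, smul_eq_mul, mul_one, Nat.cast_add] at ih ⊢
    rw [ih]

/-- The normalized measure `(∑ w)⁻¹ ∑ w · δ_{x i}` coded by a list of pairs `(i, w)` of natural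
numbers. A list of total weight zero is a code of the Dirac measure at `x 0`. -/
noncomputable def ratMeasureOfList (x : ℕ → X) (l : List (ℕ × ℕ)) : ProbabilityMeasure X :=
  if h : totalWeight l = 0 then ⟨Measure.dirac (x 0), inferInstance⟩
  else ⟨(totalWeight l : ℝ≥0∞)⁻¹ • weightedSum x l, ⟨by
    rw [Measure.smul_apply, weightedSum_univ, smul_eq_mul]
    exact ENNReal.inv_mul_cancel (by exact_mod_cast h) (ENNReal.natCast_ne_top _)⟩⟩

/-- The standard effective enumeration of the probability measures that are concentrated on a finite
set of special points and give rational mass to each of them. -/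
noncomputable def ratMeasure (x : ℕ → X) (n : ℕ) : ProbabilityMeasure X :=
  ratMeasureOfList x (Denumerable.ofNat (List (ℕ × ℕ)) n)

end RationalMeasures

section Wasserstein

variable {X : Type*} [MeasurableSpace X]

/-- `γ` is a transference plan with marginals `μ` and `ν`. -/
def IsTransferencePlan (γ : Measure (X × X)) (μ ν : Measure X) : Prop :=
  γ.fst = μ ∧ γ.snd = ν

/-- The optimal transportation cost for the cost function `c`: the infimum of `∫ c dγ` over all
transference plans `γ`. -/
noncomputable def optimalCost (c : X → X → ℝ≥0∞) (μ ν : Measure X) : ℝ≥0∞ :=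
  ⨅ (γ : Measure (X × X)) (_ : IsTransferencePlan γ μ ν), ∫⁻ z, c z.1 z.2 ∂γ

/-- The Wasserstein metric of order `p`: `W_p(μ, ν) = 𝕀_p(μ, ν) ^ (1 / p)`, with the cost function
`c_p(x, y) = d(x, y) ^ p`. -/
noncomputable def wassersteinDist [MetricSpace X] (p : ℝ) (μ ν : ProbabilityMeasure X) : ℝ :=
  (optimalCost (fun x y : X => edist x y ^ p) (μ : Measure X) (ν : Measure X) ^ (1 / p)).toReal

/-- The Prokhorov metric on probability measures. -/
noncomputable def prokhorovDist [MetricSpace X] (μ ν : ProbabilityMeasure X) : ℝ :=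
  levyProkhorovDist (μ : Measure X) (ν : Measure X)

end Wasserstein

/-- Programs of oracle machines: the constructors of Mathlib's `Nat.RecursiveIn` as a syntax. -/
inductive OracleCode : Type
  | zero : OracleCode
  | succ : OracleCode
  | left : OracleCode
  | right : OracleCode
  | oracle : OracleCode
  | pair : OracleCode → OracleCode → OracleCode
  | comp : OracleCode → OracleCode → OracleCode
  | prec : OracleCode → OracleCode → OracleCode
  | rfind : OracleCode → OracleCode

/-- The partial function computed by a program with oracle `g : ℕ → ℕ`. -/
def OracleCode.eval (g : ℕ → ℕ) : OracleCode → ℕ →. ℕ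
  | OracleCode.zero => fun _ => Part.some 0
  | OracleCode.succ => fun n => Part.some (n + 1)
  | OracleCode.left => fun n => Part.some (Nat.unpair n).1
  | OracleCode.right => fun n => Part.some (Nat.unpair n).2
  | OracleCode.oracle => fun n => Part.some (g n)
  | OracleCode.pair cf ch => fun n => Nat.pair <$> eval g cf n <*> eval g ch n
  | OracleCode.comp cf ch => fun n => eval g ch n >>= eval g cf
  | OracleCode.prec cf ch => fun m =>
      (Nat.unpair m).2.rec (eval g cf (Nat.unpair m).1) fun y IH => do
        let i ← IH
        eval g ch (Nat.pair (Nat.unpair m).1 (Nat.pair y i))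
  | OracleCode.rfind cf => fun a =>
      Nat.rfind fun n => (fun m => decide (m = 0)) <$> eval g cf (Nat.pair a n)

section CauchyNames

variable {M : Type*}

/-- `f` is a Cauchy name of `x` with respect to the metric `ρ` and the sequence `s` of special
points: the `k`-th named special point is within `2⁻ᵏ` of `x`. -/
def IsCauchyName (s : ℕ → M) (ρ : M → M → ℝ) (x : M) (f : ℕ → ℕ) : Prop :=
  ∀ k : ℕ, ρ (s (f k)) x ≤ 1 / 2 ^ k

/-- A single oracle program computes, from any `ρ₁`-Cauchy name of any `x`, a `ρ₂`-Cauchy name of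
the same `x`. -/
def CauchyNameReducible (s : ℕ → M) (ρ₁ ρ₂ : M → M → ℝ) : Prop :=
  ∃ c : OracleCode, ∀ (x : M) (f : ℕ → ℕ), IsCauchyName s ρ₁ x f →
    ∃ g : ℕ → ℕ, (∀ n, c.eval f n = Part.some (g n)) ∧ IsCauchyName s ρ₂ x g

/-- Two metrics are computably equivalent if Cauchy names with respect to each of them can be
computed from Cauchy names with respect to the other. -/
def ComputablyEquivalent (s : ℕ → M) (ρ₁ ρ₂ : M → M → ℝ) : Prop :=
  CauchyNameReducible s ρ₁ ρ₂ ∧ CauchyNameReducible s ρ₂ ρ₁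

end CauchyNames

/-! ### Converting Cauchy names by passing to a subsequence -/

section OraclePrograms

/-! The three metrics are Hölder comparable on the pairs that matter. If `C` bounds the metric, then
`W_1 ≤ W_p` (Jensen), `W_p ^ p ≤ C ^ (p - 1) * W_1` (pointwise), `π ^ 2 ≤ W_1` (Markov) and `W_1 ≤
(1 + C) * π`. A Hölder bound turns precision `2⁻ᵏ` into precision `2^-(m * k + c)`, so a name is
converted by reading the old one at `m * k + c`, with the numbers `m` and `c` built into the
program.

Only the last bound is deep (Strassen). It is needed just for a first argument `δ_n`, which is
uniform on a finite family of points with repetitions. Cutting `X` according to which of these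
points are `ε`-close makes the problem finite, and Hall's theorem yields a partial coupling that
moves mass by at most `ε`; the uncoupled mass, about `ε`, costs at most `C` per unit. -/

theorem OracleCode.exists_eval_of_primrec {h : ℕ → ℕ} (hh : Nat.Primrec h) :
    ∃ c : OracleCode, ∀ (g : ℕ → ℕ) (n : ℕ), c.eval g n = Part.some (h n) := by
  induction hh with
  | zero => exact ⟨.zero, fun _ _ => rfl⟩
  | succ => exact ⟨.succ, fun _ _ => rfl⟩
  | left => exact ⟨.left, fun _ _ => rfl⟩
  | right => exact ⟨.right, fun _ _ => rfl⟩
  | pair _ _ ihf ihg =>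
    obtain ⟨cf, hf⟩ := ihf
    obtain ⟨cg, hg⟩ := ihg
    exact ⟨.pair cf cg, fun g n => by simp [OracleCode.eval, hf, hg, Seq.seq]⟩
  | comp _ _ ihf ihg =>
    obtain ⟨cf, hf⟩ := ihf
    obtain ⟨cg, hg⟩ := ihg
    exact ⟨.comp cf cg, fun g n => by
      simp only [OracleCode.eval, hg]
      exact (Part.bind_some _ _).trans (hf g _)⟩
  | prec _ _ ihf ihg =>
    obtain ⟨cf, hf⟩ := ihf
    obtain ⟨cg, hg⟩ := ihg
    refine ⟨.prec cf cg, fun g n => ?_⟩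
    simp only [OracleCode.eval, Nat.unpaired]
    induction n.unpair.2 with
    | zero => simp [hf]
    | succ y ih =>
      dsimp only
      rw [ih]
      exact (Part.bind_some _ _).trans (hg g _)

/-- If `ρ₂` is controlled by `ρ₁` with a linear modulus in the exponents, then Cauchy names can be
converted by passing to a subsequence. -/
theorem CauchyNameReducible.of_linear_modulus {M : Type*} {s : ℕ → M} {ρ₁ ρ₂ : M → M → ℝ}
    (m c : ℕ) (H : ∀ (x : M) (n k : ℕ), ρ₁ (s n) x ≤ 1 / 2 ^ (m * k + c) → ρ₂ (s n) x ≤ 1 / 2 ^ k) :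
    CauchyNameReducible s ρ₁ ρ₂ := by
  have hprim : Nat.Primrec fun k => m * k + c :=
    Primrec.nat_iff.1 (Primrec.nat_add.comp
      (Primrec.nat_mul.comp (Primrec.const m) Primrec.id) (Primrec.const c))
  obtain ⟨code, hcode⟩ := OracleCode.exists_eval_of_primrec hprim
  refine ⟨.comp .oracle code, fun x f hf => ⟨fun k => f (m * k + c), fun n => ?_, fun k => ?_⟩⟩
  · simp [OracleCode.eval, hcode]
  · exact H x _ k (hf _)

end OraclePrograms

/-! ### Hall's theorem for real weights -/

section FractionalHall

open Finset
open scoped NNReal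

/-- A fractional version of Hall's marriage theorem with deficiency `ε`: the uniform distribution on
`T` is transported along `R` into the weights `b`, up to a mass of at most `ε + η`. -/
theorem exists_flow_of_card_div_le {T κ : Type*} [Fintype T] [Nonempty T] [Fintype κ]
    (R : T → κ → Prop) [DecidableRel R] (b : κ → ℝ≥0) (ε : ℝ≥0)
    (h : ∀ A : Finset T, (#A : ℝ≥0) / Fintype.card T ≤ ∑ s with ∃ t ∈ A, R t s, b s + ε)
    {η : ℝ≥0} (hη : 0 < η) :
    ∃ f : T → κ → ℝ≥0, (∀ t s, f t s ≠ 0 → R t s) ∧ (∀ t, ∑ s, f t s ≤ (Fintype.card T : ℝ≥0)⁻¹) ∧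
      (∀ s, ∑ t, f t s ≤ b s) ∧ 1 ≤ ∑ t, ∑ s, f t s + ε + η := by
  classical
  have hN : (0 : ℝ≥0) < Fintype.card T := by exact_mod_cast Fintype.card_pos
  obtain ⟨K, hK⟩ := exists_nat_gt (((Fintype.card κ : ℝ≥0) + 1) / η)
  -- Each `t` is split into `K` copies of mass `1 / M`. The rounding loses at most one slot per
  -- element of `κ` and one more for the ceiling in `L`; this `K` keeps the loss below `η`.
  have hK0 : (0 : ℝ≥0) < K := pos_of_gt hK
  set M : ℝ≥0 := Fintype.card T * K with hM
  have hM0 : 0 < M := mul_pos hN hK0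
  have hMη : (Fintype.card κ : ℝ≥0) + 1 ≤ M * η := by
    rw [div_lt_iff₀ hη] at hK
    refine hK.le.trans (mul_le_mul_left ?_ η)
    exact le_mul_of_one_le_left hK0.le (by exact_mod_cast Fintype.card_pos)
  -- `L` wildcard slots, open to every copy, absorb the deficiency `ε`; the summand `Fintype.card κ`
  -- makes up for the floors.
  set L : ℕ := ⌈ε * M⌉₊ + Fintype.card κ with hL
  let r : T × Fin K → (Σ s : κ, Fin ⌊b s * M⌋₊) ⊕ Fin L → Prop :=
    fun a => Sum.elim (fun x => R a.1 x.1) fun _ => True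
  obtain ⟨φ, hφ, hφr⟩ := (Fintype.all_card_le_filter_rel_iff_exists_injective r).1 (by
    intro A
    rcases A.eq_empty_or_nonempty with rfl | ⟨a₀, ha₀⟩
    · simp
    set B : Finset κ := univ.filter fun s => ∃ t ∈ A.image Prod.fst, R t s with hB
    have hsub : (B.sigma fun s => (univ : Finset (Fin ⌊b s * M⌋₊))).disjSum
        (univ : Finset (Fin L)) ⊆ univ.filter fun y => ∃ a ∈ A, r a y := by
      rintro (⟨s, i⟩ | i) hx
      · simp only [hB, inl_mem_disjSum, mem_sigma, mem_filter, mem_univ, true_and, and_true,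
          mem_image] at hx ⊢
        obtain ⟨_, ⟨a, ha, rfl⟩, hR⟩ := hx
        exact ⟨a, ha, hR⟩
      · simp only [mem_filter, mem_univ, true_and]
        exact ⟨a₀, ha₀, trivial⟩
    refine le_trans ?_ (card_le_card hsub)
    rw [card_disjSum, card_sigma]
    simp only [card_univ, Fintype.card_fin]
    -- Hall's condition for `A` follows from the one for the full fibres over its projection to `T`.
    have h1 : #A ≤ #(A.image Prod.fst) * K := by
      have : A ⊆ (A.image Prod.fst) ×ˢ (univ : Finset (Fin K)) := fun a ha => by
        simpa using ⟨a.2, ha⟩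
      simpa using card_le_card this
    have h2 : (#(A.image Prod.fst) : ℝ≥0) * K ≤ (∑ s ∈ B, b s + ε) * M := by
      have := h (A.image Prod.fst)
      rw [div_le_iff₀ hN] at this
      calc (#(A.image Prod.fst) : ℝ≥0) * K ≤ ((∑ s ∈ B, b s + ε) * Fintype.card T) * K := by
            gcongr
        _ = _ := by rw [hM, mul_assoc]
    have h3 : (∑ s ∈ B, b s + ε) * M ≤ (∑ s ∈ B, ⌊b s * M⌋₊ + L : ℕ) := by
      rw [add_mul, sum_mul]
      push_cast [hL]
      calc ∑ s ∈ B, b s * M + ε * M ≤ ∑ s ∈ B, ((⌊b s * M⌋₊ : ℝ≥0) + 1) + ⌈ε * M⌉₊ := by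
            gcongr with s
            · exact (Nat.lt_floor_add_one _).le
            · exact Nat.le_ceil _
        _ = ∑ s ∈ B, (⌊b s * M⌋₊ : ℝ≥0) + (⌈ε * M⌉₊ + #B) := by
            rw [sum_add_distrib]; simp only [sum_const, nsmul_eq_mul, mul_one]; ring
        _ ≤ _ := by
            gcongr
            exact card_le_univ B
    have h4 : (#A : ℝ≥0) ≤ (∑ s ∈ B, ⌊b s * M⌋₊ + L : ℕ) :=
      le_trans (by exact_mod_cast h1) (h2.trans h3)
    exact_mod_cast h4)
  -- The value `none` marks copies matched to a wildcard; they carry the untransported mass.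
  let σ : T × Fin K → Option κ := fun a => Sum.elim (fun x => some x.1) (fun _ => none) (φ a)
  have hrow (t : T) : ∑ s, #{j | σ (t, j) = some s} + #{j | σ (t, j) = none} = K := by
    have := card_eq_sum_card_fiberwise (f := fun j => σ (t, j)) (s := univ) (t := univ)
      fun _ _ => mem_coe.2 (mem_univ _)
    rw [Fintype.sum_option] at this
    simp only [card_univ, Fintype.card_fin] at this
    omega
  have hfiber (o : Option κ) : ∑ t, #{j | σ (t, j) = o} = #{a | σ a = o} := by
    rw [card_eq_sum_card_fiberwise (f := Prod.fst) (s := {a | σ a = o}) (t := univ)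
      fun _ _ => mem_coe.2 (mem_univ _)]
    refine sum_congr rfl fun t _ => ?_
    refine card_bij (fun j _ => (t, j)) (by simp) (by simp) ?_
    rintro ⟨t', j⟩ ha
    simp only [mem_filter, mem_univ, true_and] at ha
    obtain ⟨ha, rfl⟩ := ha
    exact ⟨j, by simpa using ha, rfl⟩
  have hcol (s : κ) : #{a | σ a = some s} ≤ ⌊b s * M⌋₊ := by
    have : #{a | σ a = some s} ≤
        #((univ : Finset (Fin ⌊b s * M⌋₊)).image
          fun i => (Sum.inl ⟨s, i⟩ : (Σ s : κ, Fin ⌊b s * M⌋₊) ⊕ Fin L)) := by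
      refine card_le_card_of_injOn φ (fun a ha => ?_) hφ.injOn
      simp only [coe_filter, mem_univ, true_and, Set.mem_ofPred_eq, σ] at ha
      rcases hx : φ a with ⟨s', i⟩ | i
      · rw [hx] at ha
        obtain rfl : s' = s := by simpa using ha
        simp
      · simp [hx] at ha
    exact this.trans (card_image_le.trans (by simp))
  have hnone : #{a | σ a = none} ≤ L := by
    have : #{a | σ a = none} ≤ #((univ : Finset (Fin L)).image
          fun i => (Sum.inr i : (Σ s : κ, Fin ⌊b s * M⌋₊) ⊕ Fin L)) := by
      refine card_le_card_of_injOn φ (fun a ha => ?_) hφ.injOn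
      simp only [coe_filter, mem_univ, true_and, Set.mem_ofPred_eq, σ] at ha
      rcases hx : φ a with ⟨s', i⟩ | i
      · simp [hx] at ha
      · simp
    exact this.trans (card_image_le.trans (by simp))
  refine ⟨fun t s => (#{j | σ (t, j) = some s} : ℝ≥0) / M, fun t s hts => ?_, fun t => ?_,
    fun s => ?_, ?_⟩
  · have hne : #{j | σ (t, j) = some s} ≠ 0 := by
      intro h0
      simp [h0] at hts
    obtain ⟨j, hj⟩ := card_ne_zero.1 hne
    simp only [mem_filter, mem_univ, true_and, σ] at hj
    have hr := hφr (t, j)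
    rcases hx : φ (t, j) with ⟨s', i⟩ | i
    · rw [hx] at hj hr
      obtain rfl : s' = s := by simpa using hj
      exact hr
    · simp [hx] at hj
  · rw [← sum_div, div_le_iff₀ hM0, hM, inv_mul_cancel_left₀ hN.ne']
    have := hrow t
    exact_mod_cast (show ∑ s, #{j | σ (t, j) = some s} ≤ K by omega)
  · rw [← sum_div, div_le_iff₀ hM0]
    refine le_trans ?_ (Nat.floor_le (zero_le : 0 ≤ b s * M))
    have := (hfiber (some s)).trans_le (hcol s)
    exact_mod_cast this
  · have htot : M = ∑ t, ∑ s, (#{j | σ (t, j) = some s} : ℝ≥0) + (#{a | σ a = none} : ℝ≥0) := by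
      rw [← hfiber none]
      push_cast
      rw [← sum_add_distrib, hM]
      have : ∀ t, ∑ s, (#{j | σ (t, j) = some s} : ℝ≥0) + (#{j | σ (t, j) = none} : ℝ≥0) = K :=
        fun t => by exact_mod_cast hrow t
      simp [this]
    have hn : (#{a | σ a = none} : ℝ≥0) ≤ ε * M + η * M := by
      calc (#{a | σ a = none} : ℝ≥0) ≤ (L : ℕ) := by exact_mod_cast hnone
        _ ≤ ε * M + 1 + Fintype.card κ := by
            rw [hL]; push_cast
            gcongr
            exact (Nat.ceil_lt_add_one zero_le).le
        _ = ε * M + (Fintype.card κ + 1) := by ring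
        _ ≤ ε * M + η * M := by rw [mul_comm η]; gcongr
    simp_rw [← sum_div]
    rw [← mul_le_mul_iff_left₀ hM0, one_mul, add_mul, add_mul, div_mul_cancel₀ _ hM0.ne', add_assoc]
    conv_lhs => rw [htot]
    gcongr

end FractionalHall

/-! ### Completing partial couplings -/

section Couplings

variable {X : Type*} [MeasurableSpace X]

/-- A subcoupling of two probability measures extends to a transference plan. -/
theorem exists_isTransferencePlan_add (μ ν : Measure X) [IsProbabilityMeasure μ]
    [IsProbabilityMeasure ν] {γ₀ : Measure (X × X)} (hμ : γ₀.fst ≤ μ) (hν : γ₀.snd ≤ ν) :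
    ∃ γ₁ : Measure (X × X), IsTransferencePlan (γ₀ + γ₁) μ ν := by
  have : IsFiniteMeasure γ₀.fst := isFiniteMeasure_of_le μ hμ
  have : IsFiniteMeasure γ₀.snd := isFiniteMeasure_of_le ν hν
  have hμ' := Measure.sub_add_cancel_of_le hμ
  have hν' := Measure.sub_add_cancel_of_le hν
  set μ' := μ - γ₀.fst
  set ν' := ν - γ₀.snd
  have hfin : γ₀ Set.univ ≠ ∞ := by
    rw [← Measure.fst_univ]
    exact measure_ne_top _ _
  have h1 : μ' Set.univ + γ₀ Set.univ = 1 := by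
    rw [← Measure.fst_univ, ← Measure.add_apply, hμ', measure_univ]
  have h2 : ν' Set.univ + γ₀ Set.univ = 1 := by
    rw [← Measure.snd_univ, ← Measure.add_apply, hν', measure_univ]
  have heq : μ' Set.univ = ν' Set.univ :=
    (ENNReal.add_left_inj hfin).1 (h1.trans h2.symm)
  have htop : μ' Set.univ ≠ ∞ := by
    intro h
    simp [h] at h1
  have : IsFiniteMeasure μ' := ⟨htop.lt_top⟩
  have : IsFiniteMeasure ν' := ⟨(heq ▸ htop).lt_top⟩
  have hcancel (ρ : Measure X) (hρ : ρ Set.univ = μ' Set.univ) :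
      (μ' Set.univ)⁻¹ • μ' Set.univ • ρ = ρ := by
    rcases eq_or_ne (μ' Set.univ) 0 with h0 | h0
    · rw [h0, Measure.measure_univ_eq_zero] at hρ
      simp [hρ]
    · rw [smul_smul, ENNReal.inv_mul_cancel h0 htop, one_smul]
  -- The residual marginals have equal mass, so their rescaled product couples them. If that mass is
  -- `0`, the factor is `∞`, but the product is the zero measure.
  refine ⟨(μ' Set.univ)⁻¹ • μ'.prod ν', ?_, ?_⟩
  · rw [Measure.fst_add, Measure.fst, Measure.fst, Measure.map_smul, Measure.map_fst_prod, ← heq,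
      hcancel _ rfl, add_comm]
    exact hμ'
  · rw [Measure.snd_add, Measure.snd, Measure.snd, Measure.map_smul, Measure.map_snd_prod,
      hcancel _ heq.symm, add_comm]
    exact hν'

theorem IsTransferencePlan.isProbabilityMeasure {μ ν : Measure X} [IsProbabilityMeasure μ]
    {γ : Measure (X × X)} (h : IsTransferencePlan γ μ ν) : IsProbabilityMeasure γ :=
  ⟨by rw [← Measure.fst_univ, h.1, measure_univ]⟩

theorem optimalCost_le_of_subcoupling {c : X → X → ℝ≥0∞} {C : ℝ≥0∞} (hc : ∀ x y, c x y ≤ C)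
    (μ ν : Measure X) [IsProbabilityMeasure μ] [IsProbabilityMeasure ν] {γ₀ : Measure (X × X)}
    (hμ : γ₀.fst ≤ μ) (hν : γ₀.snd ≤ ν) :
    optimalCost c μ ν ≤ ∫⁻ z, c z.1 z.2 ∂γ₀ + C * (1 - γ₀ Set.univ) := by
  obtain ⟨γ₁, hγ⟩ := exists_isTransferencePlan_add μ ν hμ hν
  have hprob := hγ.isProbabilityMeasure
  have hle : γ₁ Set.univ ≤ 1 - γ₀ Set.univ := by
    have h1 : γ₀ Set.univ + γ₁ Set.univ = 1 := by rw [← Measure.add_apply, measure_univ]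
    refine ENNReal.le_sub_of_add_le_left (fun h => ?_) h1.le
    simp [h] at h1
  refine (iInf₂_le (γ₀ + γ₁) hγ).trans ?_
  rw [lintegral_add_measure]
  gcongr
  calc ∫⁻ z, c z.1 z.2 ∂γ₁ ≤ ∫⁻ _, C ∂γ₁ := lintegral_mono fun z => hc _ _
    _ = C * γ₁ Set.univ := lintegral_const _
    _ ≤ _ := by gcongr

theorem optimalCost_le_of_forall_le {c : X → X → ℝ≥0∞} {C : ℝ≥0∞} (hc : ∀ x y, c x y ≤ C)
    (μ ν : Measure X) [IsProbabilityMeasure μ] [IsProbabilityMeasure ν] :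
    optimalCost c μ ν ≤ C := by
  simpa using optimalCost_le_of_subcoupling hc μ ν (γ₀ := 0) (by simp [Measure.zero_le])
    (by simp [Measure.zero_le])

/-- Only an inequality, since `y` need not be injective: points outside `A` may land in `y '' A`. -/
theorem card_div_card_le_smul_sum_dirac_image {T : Type*} [Fintype T] (y : T → X) (A : Finset T) :
    (A.card : ℝ≥0∞) / Fintype.card T ≤
      ((Fintype.card T : ℝ≥0∞)⁻¹ • ∑ t, Measure.dirac (y t)) (y '' A) := by
  rw [Measure.smul_apply, smul_eq_mul, ENNReal.div_eq_inv_mul, Measure.finsetSum_apply]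
  gcongr
  calc (A.card : ℝ≥0∞) = ∑ t ∈ A, Measure.dirac (y t) (y '' A) := by
        rw [Finset.sum_congr rfl fun t ht =>
          Measure.dirac_apply_of_mem (Set.mem_image_of_mem y (Finset.mem_coe.2 ht))]
        simp
    _ ≤ _ := Finset.sum_le_sum_of_subset (Finset.subset_univ A)

end Couplings

/-! ### Transport cost from the Prokhorov distance -/

section Strassen

open Metric
open scoped NNReal

variable {X : Type*} [MetricSpace X] [MeasurableSpace X] [BorelSpace X]

/-- The part of Strassen's theorem needed here: the optimal transportation cost from a uniform
distribution on finitely many points is controlled by the Prokhorov distance. -/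
theorem optimalCost_edist_le_of_levyProkhorovEDist_lt {T : Type*} [Fintype T] [Nonempty T]
    (y : T → X) (μ δ : Measure X) [IsProbabilityMeasure μ] [IsProbabilityMeasure δ]
    (hδ : δ = (Fintype.card T : ℝ≥0∞)⁻¹ • ∑ t, Measure.dirac (y t)) {C : ℝ≥0} {ε : ℝ≥0}
    (hC : ∀ x y : X, edist x y ≤ C) (h : levyProkhorovEDist δ μ < ε) :
    optimalCost (fun x y : X => edist x y) δ μ ≤ (1 + C) * ε := by
  classical
  -- The cell `P s` consists of the points whose `ε`-close `y t` are exactly those with `t ∈ s`. The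
  -- cells partition `X`, and mass may go from `t` to `P s` exactly when `t ∈ s`.
  let P : Finset T → Set X := fun s => {x | ∀ t, t ∈ s ↔ dist x (y t) < ε}
  have hPm (s) : MeasurableSet (P s) := by
    have : P s = ⋂ t, {x | t ∈ s ↔ x ∈ ball (y t) ε} := by ext x; simp [P]
    rw [this]
    refine MeasurableSet.iInter fun t => ?_
    by_cases ht : t ∈ s
    · simp only [ht, true_iff]
      exact measurableSet_ball
    · simp only [ht, false_iff]
      exact measurableSet_ball.compl
  have hPd : Pairwise (Function.onFun Disjoint P) := fun s s' hss' =>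
    Set.disjoint_left.2 fun x hx hx' => hss' (Finset.ext fun t => (hx t).trans (hx' t).symm)
  have hPu (x : X) : x ∈ P (Finset.univ.filter fun t => dist x (y t) < ε) := fun t => by simp
  have hsum : ∑ s, μ.restrict (P s) = μ := by
    rw [← Measure.sum_fintype, ← Measure.restrict_iUnion hPd hPm,
      Set.iUnion_eq_univ_iff.2 fun x => ⟨_, hPu x⟩, Measure.restrict_univ]
  let b : Finset T → ℝ≥0 := fun s => (μ (P s)).toNNReal
  have hb (s) : (b s : ℝ≥0∞) = μ (P s) := ENNReal.coe_toNNReal (measure_ne_top _ _)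
  have hall (A : Finset T) :
      (A.card : ℝ≥0) / Fintype.card T ≤ ∑ s with ∃ t ∈ A, t ∈ s, b s + ε := by
    have hN : (Fintype.card T : ℝ≥0) ≠ 0 := by exact_mod_cast Fintype.card_ne_zero
    rw [← ENNReal.coe_le_coe, ENNReal.coe_div hN]
    push_cast
    refine (card_div_card_le_smul_sum_dirac_image y A).trans ?_
    rw [← hδ]
    refine (left_measure_le_of_levyProkhorovEDist_lt h
      (A.finite_toSet.image y).measurableSet).trans ?_
    gcongr
    simp_rw [hb]
    -- The `ε`-thickening of `y '' A` is covered by the cells `P s` with `s` meeting `A`.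
    refine (measure_mono fun x hx => ?_).trans (measure_biUnion_finset_le _ _)
    obtain ⟨_, ⟨t, ht, rfl⟩, hd⟩ := mem_thickening_iff.1 hx
    refine Set.mem_iUnion₂.2 ⟨_, ?_, hPu x⟩
    simp only [Finset.mem_filter, Finset.mem_univ, true_and]
    exact ⟨t, ht, by simpa using hd⟩
  have key (η : ℝ≥0) (hη : 0 < η) :
      optimalCost (fun x y : X => edist x y) δ μ ≤ ε + C * (ε + η) := by
    obtain ⟨f, hfR, hfT, hfb, hf1⟩ :=
      exists_flow_of_card_div_le (fun (t : T) (s : Finset T) => t ∈ s) b ε hall hη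
    have hfle (t s) : f t s ≤ b s :=
      (Finset.single_le_sum (f := fun t => f t s) (fun _ _ => zero_le) (Finset.mem_univ t)).trans
        (hfb s)
    have hcancel (t s) : (f t s : ℝ≥0∞) / μ (P s) * μ (P s) = f t s := by
      rcases eq_or_ne (μ (P s)) 0 with h0 | h0
      · have h1 : b s = 0 := by simp [b, h0]
        have h2 : f t s = 0 := le_antisymm (h1 ▸ hfle t s) zero_le
        simp [h0, h2]
      · exact ENNReal.div_mul_cancel h0 (measure_ne_top _ _)
    -- The flow into a cell is spread proportionally to `μ`. On a null cell the flow vanishes, and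
    -- `0 / 0 = 0`.
    let γ₀ : Measure (X × X) :=
      ∑ t, ∑ s, ((f t s : ℝ≥0∞) / μ (P s)) • (Measure.dirac (y t)).prod (μ.restrict (P s))
    have hfst : γ₀.fst ≤ δ := by
      have : γ₀.fst = ∑ t, (∑ s, (f t s : ℝ≥0∞)) • Measure.dirac (y t) := by
        simp only [γ₀, Measure.fst]
        rw [Measure.map_finset_sum measurable_fst.aemeasurable]
        refine Finset.sum_congr rfl fun t _ => ?_
        rw [Measure.map_finset_sum measurable_fst.aemeasurable, Finset.sum_smul]
        refine Finset.sum_congr rfl fun s _ => ?_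
        rw [Measure.map_smul, Measure.map_fst_prod, Measure.restrict_apply_univ, smul_smul,
          hcancel]
      rw [this, hδ, Finset.smul_sum]
      refine Finset.sum_le_sum fun t _ => ?_
      have hN : (Fintype.card T : ℝ≥0) ≠ 0 := by exact_mod_cast Fintype.card_ne_zero
      have : ∑ s, (f t s : ℝ≥0∞) ≤ (Fintype.card T : ℝ≥0∞)⁻¹ := by
        have := ENNReal.coe_le_coe.2 (hfT t)
        rw [ENNReal.coe_inv hN] at this
        simpa using this
      gcongr
    have hsnd : γ₀.snd ≤ μ := by
      have : γ₀.snd = ∑ s, (∑ t, (f t s : ℝ≥0∞) / μ (P s)) • μ.restrict (P s) := by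
        simp only [γ₀, Measure.snd]
        rw [Finset.sum_comm, Measure.map_finset_sum measurable_snd.aemeasurable]
        refine Finset.sum_congr rfl fun s _ => ?_
        rw [Measure.map_finset_sum measurable_snd.aemeasurable, Finset.sum_smul]
        refine Finset.sum_congr rfl fun t _ => ?_
        rw [Measure.map_smul, Measure.map_snd_prod, measure_univ, one_smul]
      rw [this]
      conv_rhs => rw [← hsum]
      refine Finset.sum_le_sum fun s _ => ?_
      have : ∑ t, (f t s : ℝ≥0∞) / μ (P s) ≤ 1 := by
        simp_rw [div_eq_mul_inv]
        rw [← Finset.sum_mul, ← div_eq_mul_inv]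
        refine ENNReal.div_le_of_le_mul ?_
        rw [one_mul, ← hb]
        exact_mod_cast hfb s
      calc _ ≤ (1 : ℝ≥0∞) • μ.restrict (P s) := by gcongr
        _ = _ := one_smul _ _
    have huniv : γ₀ Set.univ = ∑ t, ∑ s, (f t s : ℝ≥0∞) := by
      simp only [γ₀, Measure.finsetSum_apply, Measure.smul_apply, smul_eq_mul]
      refine Finset.sum_congr rfl fun t _ => Finset.sum_congr rfl fun s _ => ?_
      rw [← Set.univ_prod_univ, Measure.prod_prod, measure_univ, one_mul,
        Measure.restrict_apply_univ, hcancel]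
    have hle1 : γ₀ Set.univ ≤ 1 := by
      rw [← Measure.snd_univ]
      exact (hsnd Set.univ).trans measure_univ.le
    have hcost : ∫⁻ z, edist z.1 z.2 ∂γ₀ ≤ ε := by
      have hle : ∫⁻ z, edist z.1 z.2 ∂γ₀ ≤ ∑ t, ∑ s, (ε : ℝ≥0∞) * f t s := by
        simp only [γ₀, lintegral_finsetSum_measure, lintegral_smul_measure, smul_eq_mul]
        refine Finset.sum_le_sum fun t _ => Finset.sum_le_sum fun s _ => ?_
        by_cases hts : f t s = 0
        · simp [hts]
        calc _ ≤ (f t s : ℝ≥0∞) / μ (P s) * (ε * μ (P s)) := by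
              gcongr
              rw [Measure.dirac_prod]
              refine (lintegral_map_le _ _).trans ?_
              rw [← setLIntegral_const]
              refine setLIntegral_mono' (hPm s) fun x hx => ?_
              have hd := (hx t).1 (hfR t s hts)
              rw [edist_comm, edist_dist]
              exact ENNReal.ofReal_le_of_le_toReal hd.le
          _ = ε * f t s := by rw [mul_left_comm, hcancel]
      simp_rw [← Finset.mul_sum] at hle
      rw [← huniv] at hle
      exact hle.trans (mul_le_of_le_one_right' hle1)
    refine (optimalCost_le_of_subcoupling hC δ μ hfst hsnd).trans ?_
    gcongr
    rw [tsub_le_iff_left, huniv, ← add_assoc]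
    exact_mod_cast hf1
  refine ENNReal.le_of_forall_pos_le_add fun η hη _ => ?_
  have hC1 : (0 : ℝ≥0) < C + 1 := by positivity
  refine (key (η / (C + 1)) (by positivity)).trans ?_
  have : C * (η / (C + 1)) ≤ η := by
    rw [mul_div_assoc', div_le_iff₀ hC1, mul_comm η]
    gcongr
    simp
  calc (ε : ℝ≥0∞) + C * (ε + (η / (C + 1) : ℝ≥0)) = (1 + C) * ε + (C * (η / (C + 1)) : ℝ≥0) := by
        push_cast; ring
    _ ≤ _ := by gcongr

end Strassen

/-! ### Rational measures as uniform distributions with repetitions -/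

section RatMeasureTokens
variable {X : Type*} [MeasurableSpace X]
theorem exists_weightedSum_eq_sum_dirac (x : ℕ → X) (l : List (ℕ × ℕ)) :
    ∃ y : Fin (totalWeight l) → X, weightedSum x l = ∑ t, Measure.dirac (y t) := by
  induction l with
  | nil => exact ⟨fun _ => x 0, by
      have : IsEmpty (Fin (totalWeight [])) := inferInstanceAs (IsEmpty (Fin 0))
      simp [weightedSum]⟩
  | cons a l ih =>
    obtain ⟨y, hy⟩ := ih
    have h : totalWeight (a :: l) = a.2 + totalWeight l := by simp [totalWeight]
    rw [h]
    refine ⟨Fin.append (fun _ => x a.1) y, ?_⟩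
    rw [Fin.sum_univ_add]
    simp only [Fin.append_left, Fin.append_right, ← hy]
    simp [weightedSum, ← Nat.cast_smul_eq_nsmul ℝ≥0∞]

theorem exists_ratMeasure_eq_smul_sum_dirac (x : ℕ → X) (n : ℕ) :
    ∃ (N : ℕ) (_ : NeZero N) (y : Fin N → X), (ratMeasure x n : Measure X) =
      (Fintype.card (Fin N) : ℝ≥0∞)⁻¹ • ∑ t, Measure.dirac (y t) := by
  by_cases h : totalWeight (Denumerable.ofNat (List (ℕ × ℕ)) n) = 0
  -- Codes of total weight zero denote the Dirac measure at `x 0`, a single token.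
  · exact ⟨1, inferInstance, fun _ => x 0, by simp [ratMeasure, ratMeasureOfList, h]⟩
  · obtain ⟨y, hy⟩ := exists_weightedSum_eq_sum_dirac x
      (Denumerable.ofNat (List (ℕ × ℕ)) n)
    exact ⟨_, ⟨h⟩, y, by simp [ratMeasure, ratMeasureOfList, h, hy]⟩
end RatMeasureTokens

/-! ### Inequalities between the metrics -/

section Comparison

open Metric
open scoped NNReal

variable {X : Type*} [MetricSpace X] [MeasurableSpace X]

/-- Boundedness keeps the cost finite, so `toReal` does not collapse `∞` to `0`. -/
theorem wassersteinDist_le_iff {p r : ℝ} (hp : 0 < p) (hr : 0 ≤ r) {C : ℝ≥0}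
    (hC : ∀ x y : X, edist x y ≤ C) (μ ν : ProbabilityMeasure X) :
    wassersteinDist p μ ν ≤ r ↔
      optimalCost (fun x y : X => edist x y ^ p) μ ν ≤ ENNReal.ofReal r ^ p := by
  have hfin : optimalCost (fun x y : X => edist x y ^ p) (μ : Measure X) ν ≠ ∞ :=
    ne_top_of_le_ne_top (ENNReal.rpow_ne_top_of_nonneg hp.le ENNReal.coe_ne_top)
      (optimalCost_le_of_forall_le (fun x y => ENNReal.rpow_le_rpow (hC x y) hp.le) _ _)
  rw [wassersteinDist, one_div, ← ENNReal.le_ofReal_iff_toReal_le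
    (ENNReal.rpow_ne_top_of_nonneg (inv_nonneg.2 hp.le) hfin) hr, ENNReal.rpow_inv_le_iff hp]

theorem wassersteinDist_one_le_iff {r : ℝ} (hr : 0 ≤ r) {C : ℝ≥0}
    (hC : ∀ x y : X, edist x y ≤ C) (μ ν : ProbabilityMeasure X) :
    wassersteinDist 1 μ ν ≤ r ↔
      optimalCost (fun x y : X => edist x y) μ ν ≤ ENNReal.ofReal r := by
  simpa using wassersteinDist_le_iff one_pos hr hC μ ν

theorem prokhorovDist_le_iff {r : ℝ} (hr : 0 ≤ r) (μ ν : ProbabilityMeasure X) :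
    prokhorovDist μ ν ≤ r ↔ levyProkhorovEDist (μ : Measure X) ν ≤ ENNReal.ofReal r := by
  rw [prokhorovDist, levyProkhorovDist, ← ENNReal.le_ofReal_iff_toReal_le
    (levyProkhorovEDist_ne_top _ _) hr]

/-- Holds plan by plan, from `d ^ p ≤ C ^ (p - 1) * d`. Positivity of `C` permits dividing by the
constant to move it past the infimum. -/
theorem optimalCost_edist_rpow_le {p : ℝ} (hp : 1 ≤ p) {C : ℝ≥0} (hC0 : 0 < C)
    (hC : ∀ x y : X, edist x y ≤ C) (μ ν : Measure X) :
    optimalCost (fun x y : X => edist x y ^ p) μ ν ≤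
      (C : ℝ≥0∞) ^ (p - 1) * optimalCost (fun x y : X => edist x y) μ ν := by
  have hfin : (C : ℝ≥0∞) ^ (p - 1) ≠ ∞ :=
    ENNReal.rpow_ne_top_of_nonneg (by linarith) ENNReal.coe_ne_top
  have hpos : (C : ℝ≥0∞) ^ (p - 1) ≠ 0 := by
    simpa [ENNReal.rpow_eq_zero_iff] using fun h => absurd h hC0.ne'
  rw [← ENNReal.div_le_iff' hpos hfin]
  refine le_iInf₂ fun γ hγ => ?_
  rw [ENNReal.div_le_iff' hpos hfin, ← lintegral_const_mul' _ _ hfin]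
  refine (iInf₂_le γ hγ).trans (lintegral_mono fun z => ?_)
  calc edist z.1 z.2 ^ p = edist z.1 z.2 ^ (p - 1) * edist z.1 z.2 := by
        conv_rhs => rw [← ENNReal.rpow_one (edist z.1 z.2), ← ENNReal.rpow_mul, one_mul]
        rw [← ENNReal.rpow_add_of_nonneg _ _ (by linarith) zero_le_one, sub_add_cancel]
    _ ≤ _ := by
        gcongr
        exact hC _ _

variable [BorelSpace X] [SecondCountableTopology X]

/-- Monotonicity of `L^p` norms in the exponent, applied to each plan, which is a probability
measure. -/
theorem optimalCost_edist_rpow_self_le {p : ℝ} (hp : 1 ≤ p) (μ ν : Measure X)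
    [IsProbabilityMeasure μ] :
    optimalCost (fun x y : X => edist x y) μ ν ^ p ≤
      optimalCost (fun x y : X => edist x y ^ p) μ ν := by
  have hp0 : 0 < p := by linarith
  refine le_iInf₂ fun γ hγ => ?_
  have := hγ.isProbabilityMeasure
  have h := eLpNorm'_le_eLpNorm'_of_exponent_le one_pos hp γ
    (f := fun z : X × X => dist z.1 z.2) (by fun_prop)
  have he (z : X × X) : ‖dist z.1 z.2‖ₑ = edist z.1 z.2 := by
    rw [edist_dist, Real.enorm_of_nonneg dist_nonneg]
  simp only [eLpNorm', he, ENNReal.rpow_one, ne_eq, one_ne_zero, not_false_eq_true, div_self,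
    one_div, ENNReal.le_rpow_inv_iff hp0] at h
  exact (ENNReal.rpow_le_rpow (iInf₂_le γ hγ) hp0.le).trans h

/-- By Markov's inequality, a plan of cost below `r * r` moves mass at most `r` by a distance `r` or
more; all other mass starting in `B` stays in its `r`-thickening. -/
theorem levyProkhorovEDist_le_of_optimalCost_le {μ ν : Measure X} [IsProbabilityMeasure μ]
    {ε : ℝ≥0∞} (h : optimalCost (fun x y : X => edist x y) μ ν ≤ ε * ε) :
    levyProkhorovEDist μ ν ≤ ε := by
  refine levyProkhorovEDist_le_of_forall μ ν ε fun r B hr hr' hB => ?_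
  have hlt : optimalCost (fun x y : X => edist x y) μ ν < r * r :=
    h.trans_lt (ENNReal.mul_lt_mul hr hr)
  simp only [optimalCost, iInf_lt_iff] at hlt
  obtain ⟨γ, ⟨hγ₁, hγ₂⟩, hγ⟩ := hlt
  have hr0 : r ≠ 0 := (zero_le.trans_lt hr).ne'
  have hfar : γ {z | r ≤ edist z.1 z.2} ≤ r := by
    refine (meas_ge_le_lintegral_div (by fun_prop) hr0 hr'.ne).trans ?_
    exact ENNReal.div_le_of_le_mul hγ.le
  have hm : MeasurableSet (thickening r.toReal B) := isOpen_thickening.measurableSet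
  constructor
  · rw [← hγ₁, ← hγ₂, Measure.fst_apply hB, Measure.snd_apply hm]
    refine le_trans (measure_mono fun z hz => ?_) ((measure_union_le _ _).trans
      (add_le_add_right hfar _))
    by_cases hd : r ≤ edist z.1 z.2
    · exact Or.inr hd
    · refine Or.inl (mem_thickening_iff.2 ⟨z.1, hz, ?_⟩)
      rw [dist_comm, ← ENNReal.ofReal_lt_ofReal_iff_of_nonneg dist_nonneg, ← edist_dist,
        ENNReal.ofReal_toReal hr'.ne]
      exact not_le.1 hd
  · rw [← hγ₁, ← hγ₂, Measure.snd_apply hB, Measure.fst_apply hm]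
    refine le_trans (measure_mono fun z hz => ?_) ((measure_union_le _ _).trans
      (add_le_add_right hfar _))
    by_cases hd : r ≤ edist z.1 z.2
    · exact Or.inr hd
    · refine Or.inl (mem_thickening_iff.2 ⟨z.2, hz, ?_⟩)
      rw [← ENNReal.ofReal_lt_ofReal_iff_of_nonneg dist_nonneg, ← edist_dist,
        ENNReal.ofReal_toReal hr'.ne]
      exact not_le.1 hd

omit [SecondCountableTopology X] in
theorem optimalCost_ratMeasure_le {C : ℝ≥0} (hC : ∀ x y : X, edist x y ≤ C) (x : ℕ → X) (n : ℕ)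
    (μ : ProbabilityMeasure X) :
    optimalCost (fun x y : X => edist x y) (ratMeasure x n : Measure X) μ ≤
      (1 + C) * levyProkhorovEDist (ratMeasure x n : Measure X) μ := by
  obtain ⟨N, _, y, hy⟩ := exists_ratMeasure_eq_smul_sum_dirac x n
  have hC1 : (1 + C : ℝ≥0∞) ≠ 0 := by simp
  have hC2 : (1 + C : ℝ≥0∞) ≠ ∞ := by simp
  rw [← ENNReal.div_le_iff' hC1 hC2]
  refine le_of_forall_gt fun ε hε => ?_
  obtain ⟨ε', h1, h2⟩ := ENNReal.lt_iff_exists_nnreal_btwn.1 hε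
  refine lt_of_le_of_lt ?_ h2
  rw [ENNReal.div_le_iff' hC1 hC2]
  exact optimalCost_edist_le_of_levyProkhorovEDist_lt y μ _ hy hC h1

end Comparison

/-- `c` absorbs the factor through `D ≤ 2 ^ c`; the slope `⌈p⌉₊` absorbs the power, because `2⁻ᵏ ≤
1`. -/
theorem ENNReal.exists_linear_modulus {D : ℝ≥0∞} (hD : D ≠ ∞) (p : ℝ) :
    ∃ m c : ℕ, ∀ k : ℕ, D * ENNReal.ofReal (1 / 2 ^ (m * k + c)) ≤
      ENNReal.ofReal (1 / 2 ^ k) ^ p := by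
  have h2 (n : ℕ) : ENNReal.ofReal (1 / 2 ^ n) = 2⁻¹ ^ n := by
    rw [one_div, ENNReal.ofReal_inv_of_pos (by positivity), ENNReal.ofReal_pow (by norm_num)]
    simp [ENNReal.inv_pow]
  obtain ⟨c, hc⟩ := ENNReal.exists_nat_gt hD
  have hc' : D ≤ 2 ^ c := hc.le.trans (by exact_mod_cast Nat.lt_two_pow_self.le)
  refine ⟨⌈p⌉₊, c, fun k => ?_⟩
  rw [h2, h2, pow_add, mul_comm ⌈p⌉₊, pow_mul]
  have h1 : ((2⁻¹ : ℝ≥0∞) ^ k) ^ ⌈p⌉₊ ≤ (2⁻¹ ^ k) ^ p := by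
    rw [← ENNReal.rpow_natCast]
    exact ENNReal.rpow_le_rpow_of_exponent_ge (pow_le_one' (by simp) k) (Nat.le_ceil p)
  calc D * ((2⁻¹ ^ k) ^ ⌈p⌉₊ * 2⁻¹ ^ c) ≤ 2 ^ c * ((2⁻¹ ^ k) ^ p * 2⁻¹ ^ c) := by gcongr
    _ = (2⁻¹ ^ k) ^ p * (2 * 2⁻¹) ^ c := by rw [mul_pow]; ring
    _ = _ := by rw [ENNReal.mul_inv_cancel (by simp) (by simp)]; simp

theorem mainTheorem5 {X : Type*} [MetricSpace X] [CompleteSpace X] [BoundedSpace X]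
    [MeasurableSpace X] [BorelSpace X] (S : ComputableMetricSpace X) (p : ℝ) (hp : 1 < p) :
    ComputablyEquivalent (ratMeasure S.point) (wassersteinDist (X := X) p) (wassersteinDist 1) ∧
    ComputablyEquivalent (ratMeasure S.point) (wassersteinDist (X := X) p) prokhorovDist := by
  have : TopologicalSpace.SeparableSpace X :=
    S.denseRange_point.separableSpace continuous_of_discreteTopology
  have : SecondCountableTopology X := UniformSpace.secondCountable_of_separable X
  have hp0 : 0 < p := one_pos.trans hp
  obtain ⟨C, hC0, hC⟩ : ∃ C : NNReal, 0 < C ∧ ∀ x y : X, edist x y ≤ C := by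
    have h := Metric.isBounded_iff_ediam_ne_top.1 (Bornology.IsBounded.all (Set.univ : Set X))
    -- The `+ 1` keeps `C` positive when `X` has at most one point.
    refine ⟨(Metric.ediam (Set.univ : Set X)).toNNReal + 1, by positivity, fun x y => ?_⟩
    rw [ENNReal.coe_add, ENNReal.coe_toNNReal h]
    exact le_add_right (Metric.edist_le_ediam_of_mem (Set.mem_univ x) (Set.mem_univ y))
  have hCfin : (C : ℝ≥0∞) ^ (p - 1) ≠ ∞ :=
    ENNReal.rpow_ne_top_of_nonneg (by linarith) ENNReal.coe_ne_top
  have hone (μ ν : ProbabilityMeasure X) {r : ℝ} (hr : 0 ≤ r) (h : wassersteinDist p μ ν ≤ r) :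
      optimalCost (fun x y : X => edist x y) (μ : Measure X) ν ≤ ENNReal.ofReal r := by
    rw [wassersteinDist_le_iff hp0 hr hC] at h
    exact (ENNReal.rpow_le_rpow_iff hp0).1 ((optimalCost_edist_rpow_self_le hp.le _ _).trans h)
  refine ⟨⟨.of_linear_modulus 1 0 fun μ n k h => ?_, ?_⟩,
    ⟨.of_linear_modulus 2 0 fun μ n k h => ?_, ?_⟩⟩
  · rw [wassersteinDist_one_le_iff (by positivity) hC]
    exact hone _ _ (by positivity) (by simpa using h)
  · obtain ⟨m, c, H⟩ := ENNReal.exists_linear_modulus hCfin p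
    refine .of_linear_modulus m c fun μ n k h => ?_
    rw [wassersteinDist_one_le_iff (by positivity) hC] at h
    rw [wassersteinDist_le_iff hp0 (by positivity) hC]
    refine (optimalCost_edist_rpow_le hp.le hC0 hC _ _).trans (le_trans ?_ (H k))
    gcongr
  · rw [prokhorovDist_le_iff (by positivity)]
    refine levyProkhorovEDist_le_of_optimalCost_le ((hone _ _ (by positivity) h).trans_eq ?_)
    rw [← ENNReal.ofReal_mul (by positivity)]
    congr 1
    rw [div_mul_div_comm, ← pow_add]
    ring
  -- The bounds of `W_p` by `W_1` and of `W_1` by `π` are chained at the level of costs, which gives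
  -- the factor `C ^ (p - 1) * (1 + C)`.
  · obtain ⟨m, c, H⟩ := ENNReal.exists_linear_modulus
      (ENNReal.mul_ne_top hCfin (show (1 + C : ℝ≥0∞) ≠ ∞ by simp)) p
    refine .of_linear_modulus m c fun μ n k h => ?_
    rw [prokhorovDist_le_iff (by positivity)] at h
    rw [wassersteinDist_le_iff hp0 (by positivity) hC]
    refine (optimalCost_edist_rpow_le hp.le hC0 hC _ _).trans (le_trans ?_ (H k))
    rw [mul_assoc]
    gcongr
    refine (optimalCost_ratMeasure_le hC S.point n μ).trans ?_
    gcongr
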